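/- Let $G$ be a locally compact Polish abelian group with Haar measure $\lambda$ (arbitrarily normalized); $G\times G$ carries $\lambda\otimes\lambda$. For a random element $X$ (of $G$ or $G\times G$) whose law has a density $f$ with respect to this reference measure, let $h(X)=-\int f\log f$. For $G$-valued $X,Y$ on a common probability space put $h(X|Y)=h(X,Y)-h(Y)$, $I(X;Y)=h(X)+h(Y)-h(X,Y)$ and $\tilde d_R(X\|Y)=h(X-Y)-h(X)$. A triple of $G$-valued random variables forms a Markov chain $X_1\leftrightarrow Y\leftrightarrow X_2$ if the conditional distribution of $X_1$ given $(Y,X_2)$ equals that of $X_1$ given $Y$; in that case put $d_R(X_1\|X_2|Y)=h(X_1-X_2|Y)-h(X_1|Y)$. Let $X_1\leftrightarrow Y\leftrightarrow X_2$ be a Markov chain of $G$-valued random variables, and assume that the entropies of $X_1$, $Y$, $X_2$, $(X_1,Y)$, $(X_2,Y)$, $(X_1-X_2,Y)$, $X_1-Y$ and $Y-X_2$ are well defined (that is, the densities exist) and finite. Then $$d_R(X_1\|X_2|Y)\le 2I(X_1;Y)+I(X_2;Y)+\tilde d_R(X_1\|Y)+\tilde d_R(Y\|X_2).$$ If moreover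 $X_1$ and $X_2$ have the same conditional distribution given $Y$, then, for any $G$-valued $X$ on the same space that also has this conditional distribution given $Y$ (for instance $X=X_1$), $$d_R(X_1\|X_2|Y)\le 3I(X;Y)+\tilde d_R(X\|Y)+\tilde d_R(Y\|X).$$ -/

import Mathlib

open MeasureTheory ProbabilityTheory

noncomputable section

namespace RuzsaDiv

/-- The random object `X`, on a space with reference measure `lam`, has a density with respect to
`lam`, and its entropy is well defined and finite: the integral of `f log f` converges absolutely,
where `f` is the density of `X`. -/
structure HasFiniteEntropy {Ω S : Type*} [MeasurableSpace Ω] [MeasurableSpace S]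
    (P : Measure Ω) (lam : Measure S) (X : Ω → S) : Prop where
  absolutelyContinuous : P.map X ≪ lam
  integrable : Integrable (fun x => Real.negMulLog ((P.map X).rnDeriv lam x).toReal) lam

/-- The entropy `h(X) = - ∫ f log f ∂lam`, where `f` is the density of `X` with respect to `lam`.
Meaningful under `HasFiniteEntropy P lam X`. -/
def entropy {Ω S : Type*} [MeasurableSpace Ω] [MeasurableSpace S]
    (P : Measure Ω) (lam : Measure S) (X : Ω → S) : ℝ :=
  ∫ x, Real.negMulLog ((P.map X).rnDeriv lam x).toReal ∂lam

section TwoVariables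

variable {Ω G : Type*} [MeasurableSpace Ω] [MeasurableSpace G]

/-- The pair `(X, Y)` as a single random object with values in `G × G`. -/
def pair (X Y : Ω → G) : Ω → G × G := fun ω => (X ω, Y ω)

/-- The conditional entropy `h(X | Y) = h(X, Y) - h(Y)`, where the joint entropy is taken with
respect to the product measure. -/
def condEntropy (P : Measure Ω) (lam : Measure G) (X Y : Ω → G) : ℝ :=
  entropy P (lam.prod lam) (pair X Y) - entropy P lam Y

/-- The mutual information `I(X ; Y) = h(X) + h(Y) - h(X, Y)`. -/
def mutualInfo (P : Measure Ω) (lam : Measure G) (X Y : Ω → G) : ℝ :=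
  entropy P lam X + entropy P lam Y - entropy P (lam.prod lam) (pair X Y)

/-- The conditional Ruzsa divergence `d_R(X₁ ‖ X₂ | Y) = h(X₁ - X₂ | Y) - h(X₁ | Y)`, used when
`X₁ ↔ Y ↔ X₂` is a Markov chain. -/
def condRuzsaDivergence [Sub G] (P : Measure Ω) (lam : Measure G) (X₁ X₂ Y : Ω → G) : ℝ :=
  condEntropy P lam (fun ω => X₁ ω - X₂ ω) Y - condEntropy P lam X₁ Y

/-- The Ruzsa difference `h(X - Y) - h(X)` of two possibly dependent random variables. -/
def ruzsaDifference [Sub G] (P : Measure Ω) (lam : Measure G) (X Y : Ω → G) : ℝ :=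
  entropy P lam (fun ω => X ω - Y ω) - entropy P lam X

/-- `X ↔ Z ↔ Y` is a Markov chain: the conditional distribution of `X` given `(Z, Y)` is the same
as that of `X` given `Z` alone. -/
def IsMarkovChain [StandardBorelSpace G] [Nonempty G] (P : Measure Ω) [IsFiniteMeasure P]
    (X Z Y : Ω → G) : Prop :=
  ∀ᵐ p ∂(P.map (pair Z Y)), condDistrib X (pair Z Y) P p = condDistrib X Z P p.1

/-- `X` and `X'` have the same conditional distribution given `Y`. -/
def SameCondDistrib [StandardBorelSpace G] [Nonempty G] (P : Measure Ω) [IsFiniteMeasure P]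
    (X X' Y : Ω → G) : Prop :=
  ∀ᵐ y ∂(P.map Y), condDistrib X Y P y = condDistrib X' Y P y

end TwoVariables

end RuzsaDiv

end

namespace RuzsaDiv

/-! Put U = X₁ - Y and V = Y - X₂, so U + V = X₁ - X₂. After the definitions are expanded, the first
claim is h(X₁-X₂,Y) + h(X₁,Y) + h(X₂,Y) ≤ h(X₁) + h(X₂) + h(U) + h(V) + 2h(Y), which is
`IsMarkovChain.entropy_sub_pair_add_le`.

In Shannon's terms: the Markov property gives h(X₁,Y,X₂) = h(X₁,Y) + h(X₂,Y) - h(Y). Both (X₁,X₂)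
and (U,V) determine X₁-X₂, and together they determine the triple, so submodularity reads h(X₁,Y,X₂)
+ h(X₁-X₂) ≤ h(X₁,X₂) + h(U,V). Adding subadditivity for (X₁,X₂), (U,V) and (X₁-X₂,Y) gives the
claim.

The entropies of (X₁,X₂), (U,V) and X₁-X₂ are not assumed finite, so these inequalities cannot be
added as numbers. Instead each is written as E log R ≤ 0 for a likelihood ratio R with E R ≤ 1. The
unwanted densities cancel in the sum of the four logarithms, which is integrable, and log r ≤ r - 1
is applied before integrating (`integral_nonpos_of_eq_sum_log`). -/

/-- `Z` is a random object with density `f` with respect to `μ`. -/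
structure IsDensity {Ω S : Type*} [MeasurableSpace Ω] [MeasurableSpace S]
    (P : Measure Ω) (μ : Measure S) (Z : Ω → S) (f : S → ENNReal) : Prop where
  measurable_var : Measurable Z
  measurable_density : Measurable f
  map_eq : P.map Z = μ.withDensity f

/-! ### Densities, entropy as an expectation, and Gibbs' inequality. -/

section General

variable {Ω S : Type*} [MeasurableSpace Ω] [MeasurableSpace S] {P : Measure Ω} {μ : Measure S}
  {Z : Ω → S} {f : S → ENNReal}

theorem isDensity_rnDeriv [IsFiniteMeasure P] [SigmaFinite μ] (hZ : Measurable Z)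
    (h : P.map Z ≪ μ) : IsDensity P μ Z ((P.map Z).rnDeriv μ) :=
  ⟨hZ, Measure.measurable_rnDeriv _ _, (Measure.withDensity_rnDeriv_eq _ _ h).symm⟩

theorem isDensity_of_lintegral (hZ : Measurable Z) (hf : Measurable f)
    (h : ∀ g : S → ENNReal, Measurable g → ∫⁻ ω, g (Z ω) ∂P = ∫⁻ x, f x * g x ∂μ) :
    IsDensity P μ Z f := by
  refine ⟨hZ, hf, Measure.ext fun s hs => ?_⟩
  have h1 := h (s.indicator 1) (measurable_one.indicator hs)
  rw [← lintegral_map (measurable_one.indicator hs) hZ, lintegral_indicator_one hs] at h1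
  rw [h1, withDensity_apply _ hs, ← lintegral_indicator hs]
  refine lintegral_congr fun x => ?_
  by_cases hx : x ∈ s <;> simp [hx]

theorem IsDensity.absolutelyContinuous (h : IsDensity P μ Z f) : P.map Z ≪ μ := by
  rw [h.map_eq]; exact withDensity_absolutelyContinuous _ _

theorem IsDensity.lintegral_comp (h : IsDensity P μ Z f) {g : S → ENNReal} (hg : Measurable g) :
    ∫⁻ ω, g (Z ω) ∂P = ∫⁻ x, f x * g x ∂μ := by
  rw [← lintegral_map hg h.measurable_var, h.map_eq,
    lintegral_withDensity_eq_lintegral_mul _ h.measurable_density hg]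
  rfl

theorem IsDensity.lintegral_eq_one [IsProbabilityMeasure P] (h : IsDensity P μ Z f) :
    ∫⁻ x, f x ∂μ = 1 := by
  simpa using (h.lintegral_comp (g := fun _ => 1) measurable_const).symm

theorem IsDensity.ae_pos_finite [IsProbabilityMeasure P] (h : IsDensity P μ Z f) :
    ∀ᵐ ω ∂P, f (Z ω) ≠ 0 ∧ f (Z ω) ≠ ⊤ := by
  have h1 : ∀ᵐ x ∂(P.map Z), f x ≠ 0 := by
    rw [h.map_eq, ae_withDensity_iff h.measurable_density]
    exact Filter.Eventually.of_forall fun _ hx => hx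
  have h2 : ∀ᵐ x ∂(P.map Z), f x < ⊤ :=
    h.absolutelyContinuous.ae_le (ae_lt_top h.measurable_density (by simp [h.lintegral_eq_one]))
  filter_upwards [ae_of_ae_map h.measurable_var.aemeasurable h1,
    ae_of_ae_map h.measurable_var.aemeasurable h2] with ω h3 h4 using ⟨h3, h4.ne⟩

/-- The left side is the integral of g over the set where f is neither 0 nor ∞, so mass of g outside
it is lost. This is what bounds the mean of a likelihood ratio by 1. -/
theorem IsDensity.lintegral_div_le (h : IsDensity P μ Z f) {g : S → ENNReal} (hg : Measurable g) :
    ∫⁻ ω, g (Z ω) / f (Z ω) ∂P ≤ ∫⁻ x, g x ∂μ := by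
  rw [h.lintegral_comp (g := fun x => g x / f x) (hg.div h.measurable_density)]
  exact lintegral_mono fun x => ENNReal.mul_div_le

/-- Integrating log f against the law f dμ is integrating f log f against μ, so entropies become
expectations on Ω and can be combined pointwise. -/
theorem HasFiniteEntropy.integrable_log [IsProbabilityMeasure P] [SigmaFinite μ]
    (hZ : Measurable Z) (h : HasFiniteEntropy P μ Z) :
    Integrable (fun ω => Real.log ((P.map Z).rnDeriv μ (Z ω)).toReal) P := by
  have hd := isDensity_rnDeriv hZ h.absolutelyContinuous
  have : Integrable (fun x => Real.log ((P.map Z).rnDeriv μ x).toReal) (P.map Z) := by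
    have key : Integrable (fun x => Real.log ((P.map Z).rnDeriv μ x).toReal)
        (μ.withDensity ((P.map Z).rnDeriv μ)) := by
      rw [integrable_withDensity_iff_integrable_smul' hd.measurable_density
        (ae_lt_top hd.measurable_density (by simp [hd.lintegral_eq_one]))]
      refine h.integrable.neg.congr (Filter.Eventually.of_forall fun x => ?_)
      simp [Real.negMulLog]
    rwa [← hd.map_eq] at key
  exact this.comp_measurable hZ

theorem HasFiniteEntropy.integral_log [IsProbabilityMeasure P] [SigmaFinite μ]
    (hZ : Measurable Z) (h : HasFiniteEntropy P μ Z) :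
    ∫ ω, Real.log ((P.map Z).rnDeriv μ (Z ω)).toReal ∂P = -entropy P μ Z := by
  have hd := isDensity_rnDeriv hZ h.absolutelyContinuous
  have hm : Measurable fun x => Real.log ((P.map Z).rnDeriv μ x).toReal :=
    Real.measurable_log.comp hd.measurable_density.ennreal_toReal
  rw [← integral_map hZ.aemeasurable
    (f := fun x => Real.log ((P.map Z).rnDeriv μ x).toReal) hm.aestronglyMeasurable]
  have key := integral_withDensity_eq_integral_toReal_smul (μ := μ) hd.measurable_density
    (ae_lt_top hd.measurable_density (by simp [hd.lintegral_eq_one]))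
    (fun x => Real.log ((P.map Z).rnDeriv μ x).toReal)
  rw [← hd.map_eq] at key
  rw [key, entropy, ← integral_neg]
  simp [Real.negMulLog]

theorem absolutelyContinuous_map_comp {T : Type*} [MeasurableSpace T] {ν : Measure T}
    {φ : S → T} (hφ : Measure.QuasiMeasurePreserving φ μ ν) (hZ : Measurable Z)
    (h : P.map Z ≪ μ) : P.map (fun ω => φ (Z ω)) ≪ ν := by
  have : P.map (fun ω => φ (Z ω)) = (P.map Z).map φ := (Measure.map_map hφ.measurable hZ).symm
  rw [this]
  exact (h.map hφ.measurable).trans hφ.absolutelyContinuous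

theorem entropy_congr_map {Z' : Ω → S} (h : P.map Z = P.map Z') :
    entropy P μ Z = entropy P μ Z' := by
  rw [entropy, h, entropy]

/-- Sum of Gibbs inequalities: only the sum of the logarithms has to be integrable. -/
theorem integral_nonpos_of_eq_sum_log [IsProbabilityMeasure P] {ι : Type*} (s : Finset ι)
    {R : ι → Ω → ENNReal} (hR : ∀ i ∈ s, Measurable (R i))
    (hpos : ∀ i ∈ s, ∀ᵐ ω ∂P, R i ω ≠ 0) (hle : ∀ i ∈ s, ∫⁻ ω, R i ω ∂P ≤ 1)
    {F : Ω → ℝ} (hF : Integrable F P)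
    (hsum : ∀ᵐ ω ∂P, F ω = ∑ i ∈ s, Real.log (R i ω).toReal) : ∫ ω, F ω ∂P ≤ 0 := by
  have hfin : ∀ i ∈ s, ∀ᵐ ω ∂P, R i ω < ⊤ := fun i hi =>
    ae_lt_top (hR i hi) ((hle i hi).trans_lt ENNReal.one_lt_top).ne
  have hint : ∀ i ∈ s, Integrable (fun ω => (R i ω).toReal) P := fun i hi =>
    integrable_toReal_of_lintegral_ne_top (hR i hi).aemeasurable
      ((hle i hi).trans_lt ENNReal.one_lt_top).ne
  have hint' : ∀ i ∈ s, Integrable (fun ω => (R i ω).toReal - 1) P := fun i hi =>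
    (hint i hi).sub (integrable_const _)
  calc ∫ ω, F ω ∂P ≤ ∫ ω, ∑ i ∈ s, ((R i ω).toReal - 1) ∂P := by
        refine integral_mono_ae hF (integrable_finsetSum s hint') ?_
        filter_upwards [hsum, (s.eventually_all).2 hpos, (s.eventually_all).2 hfin]
          with ω h1 h2 h3
        rw [h1]
        exact Finset.sum_le_sum fun i hi =>
          Real.log_le_sub_one_of_pos (ENNReal.toReal_pos (h2 i hi) (h3 i hi).ne)
    _ = ∑ i ∈ s, ∫ ω, ((R i ω).toReal - 1) ∂P := integral_finsetSum s hint'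
    _ ≤ 0 := by
        refine Finset.sum_nonpos fun i hi => ?_
        rw [integral_sub (hint i hi) (integrable_const _),
          integral_toReal (hR i hi).aemeasurable (hfin i hi)]
        have := ENNReal.toReal_mono ENNReal.one_ne_top (hle i hi)
        simp only [ENNReal.toReal_one] at this
        simp only [integral_const, probReal_univ, smul_eq_mul, mul_one]
        linarith

end General

/-! ### Joint density of a Markov chain. -/

section Markov

variable {Ω G : Type*} [MeasurableSpace Ω] [MeasurableSpace G] [StandardBorelSpace G] [Nonempty G]
  {P : Measure Ω} [IsProbabilityMeasure P] {X₁ Y X₂ : Ω → G}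

/-- The Markov property in the form in which it is used: X₁ may be redrawn from its law given Y
alone, with Y and X₂ kept. -/
theorem IsMarkovChain.lintegral (hM : IsMarkovChain P X₁ Y X₂) (hX₁ : Measurable X₁)
    (hY : Measurable Y) (hX₂ : Measurable X₂) {Φ : G × (G × G) → ENNReal} (hΦ : Measurable Φ) :
    ∫⁻ ω, Φ (Y ω, (X₁ ω, X₂ ω)) ∂P =
      ∫⁻ ω, ∫⁻ x, Φ (Y ω, (x, X₂ ω)) ∂(condDistrib X₁ Y P (Y ω)) ∂P := by
  have hp : Measurable (pair Y X₂) := hY.prodMk hX₂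
  have h1 : P.map (fun ω => (pair Y X₂ ω, X₁ ω)) =
      P.map (pair Y X₂) ⊗ₘ ((condDistrib X₁ Y P).comap Prod.fst measurable_fst) := by
    rw [← compProd_map_condDistrib hX₁.aemeasurable]
    refine Measure.compProd_congr ?_
    filter_upwards [hM] with p h
    rw [h, Kernel.comap_apply]
  have hΨ : Measurable fun q : (G × G) × G => Φ (q.1.1, (q.2, q.1.2)) := by fun_prop
  have h2 := lintegral_map (μ := P) hΨ (hp.prodMk hX₁)
  rw [h1, Measure.lintegral_compProd hΨ, lintegral_map ?_ hp] at h2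
  · exact h2.symm
  · exact hΨ.lintegral_kernel_prod_right'
      (κ := (condDistrib X₁ Y P).comap (Prod.fst : G × G → G) measurable_fst)

theorem lintegral_condDistrib (hX₁ : Measurable X₁) (hY : Measurable Y) {M : G × G → ENNReal}
    (hMm : Measurable M) :
    ∫⁻ ω, ∫⁻ x, M (Y ω, x) ∂(condDistrib X₁ Y P (Y ω)) ∂P = ∫⁻ ω, M (Y ω, X₁ ω) ∂P := by
  have h2 := lintegral_map (μ := P) hMm (hY.prodMk hX₁)
  rw [← compProd_map_condDistrib hX₁.aemeasurable, Measure.lintegral_compProd hMm,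
    lintegral_map hMm.lintegral_kernel_prod_right' hY] at h2
  exact h2

/-- The joint density of a Markov chain is `f(x₁, y) f(x₂, y) / f(y)`. -/
theorem IsMarkovChain.isDensity {lam : Measure G} [SigmaFinite lam]
    (hM : IsMarkovChain P X₁ Y X₂) {f₁ f₂ : G × G → ENNReal} {f : G → ENNReal}
    (h₁ : IsDensity P (lam.prod lam) (pair X₁ Y) f₁)
    (h₂ : IsDensity P (lam.prod lam) (pair X₂ Y) f₂) (h : IsDensity P lam Y f) :
    IsDensity P (lam.prod (lam.prod lam)) (fun ω => (Y ω, (X₁ ω, X₂ ω)))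
      (fun t => f₁ (t.2.1, t.1) * (f₂ (t.2.2, t.1) / f t.1)) := by
  have hX₁ : Measurable X₁ := measurable_fst.comp h₁.measurable_var
  have hX₂ : Measurable X₂ := measurable_fst.comp h₂.measurable_var
  have hY : Measurable Y := h.measurable_var
  have m₁ := h₁.measurable_density
  have m₂ := h₂.measurable_density
  have m := h.measurable_density
  refine isDensity_of_lintegral (by fun_prop) (by fun_prop) fun Φ hΦ => ?_
  set κ := condDistrib X₁ Y P with hκ
  have hH : Measurable fun z : G × G => ∫⁻ x, Φ (z.2, (x, z.1)) ∂(κ z.2) := by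
    have : Measurable fun q : (G × G) × G => Φ (q.1.2, (q.2, q.1.1)) := by fun_prop
    exact this.lintegral_kernel_prod_right'
      (κ := κ.comap (Prod.snd : G × G → G) measurable_snd)
  have hΨ : Measurable fun q : (G × G) × G =>
      f₂ (q.2, q.1.1) / f q.1.1 * Φ (q.1.1, (q.1.2, q.2)) := by fun_prop
  have hMm : Measurable fun p : G × G => ∫⁻ x₂, f₂ (x₂, p.1) / f p.1 * Φ (p.1, (p.2, x₂)) ∂lam :=
    hΨ.lintegral_prod_right'
  have hK : Measurable fun y => ∫⁻ x, ∫⁻ x₂, f₂ (x₂, y) / f y * Φ (y, (x, x₂)) ∂lam ∂(κ y) :=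
    hMm.lintegral_kernel_prod_right'
  calc ∫⁻ ω, Φ (Y ω, (X₁ ω, X₂ ω)) ∂P
      = ∫⁻ ω, ∫⁻ x, Φ (Y ω, (x, X₂ ω)) ∂(κ (Y ω)) ∂P := hM.lintegral hX₁ hY hX₂ hΦ
    -- Multiplying and dividing by f(Y), almost surely positive and finite, leaves a factor f(y)
    -- that later turns dy back into the law of Y.
    _ = ∫⁻ ω, (fun z : G × G => f z.2 * ((∫⁻ x, Φ (z.2, (x, z.1)) ∂(κ z.2)) / f z.2))
          (pair X₂ Y ω) ∂P := by
        refine lintegral_congr_ae ?_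
        filter_upwards [h.ae_pos_finite] with ω hω
        exact (ENNReal.mul_div_cancel hω.1 hω.2).symm
    _ = ∫⁻ y, ∫⁻ x₂, f₂ (x₂, y) * (f y * ((∫⁻ x, Φ (y, (x, x₂)) ∂(κ y)) / f y)) ∂lam ∂lam := by
        have hm : Measurable fun z : G × G => f z.2 * ((∫⁻ x, Φ (z.2, (x, z.1)) ∂(κ z.2)) / f z.2) :=
          (m.comp measurable_snd).mul (hH.div (m.comp measurable_snd))
        exact (h₂.lintegral_comp hm).trans (lintegral_prod_symm _ (m₂.mul hm).aemeasurable)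
    _ = ∫⁻ y, f y * ∫⁻ x, ∫⁻ x₂, f₂ (x₂, y) / f y * Φ (y, (x, x₂)) ∂lam ∂(κ y) ∂lam := by
        refine lintegral_congr fun y => ?_
        rw [lintegral_lintegral_swap (by fun_prop), ← lintegral_const_mul _ (by fun_prop)]
        refine lintegral_congr fun x₂ => ?_
        rw [lintegral_const_mul _ (by fun_prop)]
        simp only [div_eq_mul_inv]
        ring
    _ = ∫⁻ ω, ∫⁻ x, ∫⁻ x₂, f₂ (x₂, Y ω) / f (Y ω) * Φ (Y ω, (x, x₂)) ∂lam ∂(κ (Y ω)) ∂P :=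
        (h.lintegral_comp hK).symm
    _ = ∫⁻ ω, ∫⁻ x₂, f₂ (x₂, Y ω) / f (Y ω) * Φ (Y ω, (X₁ ω, x₂)) ∂lam ∂P :=
        lintegral_condDistrib hX₁ hY hMm
    _ = ∫⁻ p, f₁ p * ∫⁻ x₂, f₂ (x₂, p.2) / f p.2 * Φ (p.2, (p.1, x₂)) ∂lam ∂(lam.prod lam) :=
        h₁.lintegral_comp (hMm.comp measurable_swap)
    _ = ∫⁻ t, f₁ (t.2.1, t.1) * (f₂ (t.2.2, t.1) / f t.1) * Φ t ∂(lam.prod (lam.prod lam)) := by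
        refine (lintegral_prod_symm _ (m₁.mul (hMm.comp measurable_swap)).aemeasurable).trans ?_
        rw [lintegral_prod _ (by fun_prop)]
        refine lintegral_congr fun y => ?_
        rw [lintegral_prod _ (by fun_prop)]
        refine lintegral_congr fun x => ?_
        simp only [Pi.mul_apply, Function.comp_apply, Prod.swap_prod_mk, mul_assoc]
        exact (lintegral_const_mul _ (by fun_prop)).symm

/-- The law of Y and the conditional law given Y determine the joint law. -/
theorem SameCondDistrib.map_pair_eq {X X' : Ω → G} (h : SameCondDistrib P X X' Y)
    (hX : Measurable X) (hX' : Measurable X') (hY : Measurable Y) :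
    P.map (pair X Y) = P.map (pair X' Y) := by
  have key : P.map (fun ω => (Y ω, X ω)) = P.map (fun ω => (Y ω, X' ω)) := by
    rw [← compProd_map_condDistrib hX.aemeasurable, ← compProd_map_condDistrib hX'.aemeasurable]
    exact Measure.compProd_congr h
  have := congrArg (Measure.map Prod.swap) key
  rwa [Measure.map_map measurable_swap (hY.prodMk hX),
    Measure.map_map measurable_swap (hY.prodMk hX')] at this

end Markov

/-! ### Differences in the group and the main entropy inequality. -/

section Group

variable {Ω G : Type*} [MeasurableSpace Ω] [MeasurableSpace G] [AddCommGroup G] [MeasurableAdd₂ G]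
  [MeasurableNeg G] {P : Measure Ω} {lam : Measure G} [SigmaFinite lam] [lam.IsAddLeftInvariant]

/-- For fixed y the map is a translation times a reflection, which preserves the product measure;
hence every slice of the preimage of a null set is null. -/
theorem quasiMeasurePreserving_sub_sub [lam.IsNegInvariant] :
    Measure.QuasiMeasurePreserving (fun t : G × (G × G) => (t.2.1 - t.1, t.1 - t.2.2))
      (lam.prod (lam.prod lam)) (lam.prod lam) := by
  have hm : Measurable fun t : G × (G × G) => (t.2.1 - t.1, t.1 - t.2.2) := by fun_prop
  refine ⟨hm, Measure.AbsolutelyContinuous.mk fun s hs h0 => ?_⟩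
  rw [Measure.map_apply hm hs, Measure.measure_prod_null (hm hs)]
  refine Filter.Eventually.of_forall fun y => ?_
  have h := ((measurePreserving_sub_right lam y).prod
    (Measure.measurePreserving_sub_left lam y)).measure_preimage hs.nullMeasurableSet
  rw [h0] at h
  exact h

omit [MeasurableNeg G] [SigmaFinite lam] in
-- Substitute t = y - x₂. With k the density of (U,V), the right side is the density of U + V at x₁
-- - x₂.
theorem lintegral_sub_sub [lam.IsNegInvariant] (k : G × G → ENNReal) (x₁ x₂ : G) :
    ∫⁻ y, k (x₁ - y, y - x₂) ∂lam = ∫⁻ t, k (x₁ - x₂ - t, t) ∂lam := by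
  rw [← lintegral_sub_right_eq_self (fun t => k (x₁ - x₂ - t, t)) x₂]
  simp

/-- The density of a sum. -/
theorem IsDensity.add {S T : Ω → G} {k : G × G → ENNReal}
    (h : IsDensity P (lam.prod lam) (pair S T) k) :
    IsDensity P lam (fun ω => S ω + T ω) (fun d => ∫⁻ t, k (d - t, t) ∂lam) := by
  have hk := h.measurable_density
  have hS : Measurable S := measurable_fst.comp h.measurable_var
  have hT : Measurable T := measurable_snd.comp h.measurable_var
  have hk' : Measurable fun p : G × G => k (p.1 - p.2, p.2) := by fun_prop
  refine isDensity_of_lintegral (hS.add hT) hk'.lintegral_prod_right' fun g hg => ?_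
  calc ∫⁻ ω, g (S ω + T ω) ∂P
      = ∫⁻ z, k z * g (z.1 + z.2) ∂(lam.prod lam) :=
        h.lintegral_comp (g := fun z => g (z.1 + z.2)) (by fun_prop)
    _ = ∫⁻ t, ∫⁻ s, k (s, t) * g (s + t) ∂lam ∂lam := lintegral_prod_symm _ (by fun_prop)
    _ = ∫⁻ t, ∫⁻ d, k (d - t, t) * g d ∂lam ∂lam := by
        refine lintegral_congr fun t => ?_
        rw [← lintegral_sub_right_eq_self (fun s => k (s, t) * g (s + t)) t]
        simp
    _ = ∫⁻ d, ∫⁻ t, k (d - t, t) * g d ∂lam ∂lam := lintegral_lintegral_swap (by fun_prop)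
    _ = ∫⁻ d, (∫⁻ t, k (d - t, t) ∂lam) * g d ∂lam :=
        lintegral_congr fun d => lintegral_mul_const _ (by fun_prop)

theorem log_toReal_mul {a b : ENNReal} (ha : a ≠ 0 ∧ a ≠ ⊤) (hb : b ≠ 0 ∧ b ≠ ⊤) :
    Real.log (a * b).toReal = Real.log a.toReal + Real.log b.toReal := by
  rw [ENNReal.toReal_mul, Real.log_mul (ENNReal.toReal_ne_zero.2 ha) (ENNReal.toReal_ne_zero.2 hb)]

theorem log_toReal_div {a b : ENNReal} (ha : a ≠ 0 ∧ a ≠ ⊤) (hb : b ≠ 0 ∧ b ≠ ⊤) :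
    Real.log (a / b).toReal = Real.log a.toReal - Real.log b.toReal := by
  rw [ENNReal.toReal_div, Real.log_div (ENNReal.toReal_ne_zero.2 ha) (ENNReal.toReal_ne_zero.2 hb)]

theorem mul_ne_zero_ne_top {a b : ENNReal} (ha : a ≠ 0 ∧ a ≠ ⊤) (hb : b ≠ 0 ∧ b ≠ ⊤) :
    a * b ≠ 0 ∧ a * b ≠ ⊤ :=
  ⟨mul_ne_zero ha.1 hb.1, ENNReal.mul_ne_top ha.2 hb.2⟩

theorem div_ne_zero_ne_top {a b : ENNReal} (ha : a ≠ 0 ∧ a ≠ ⊤) (hb : b ≠ 0 ∧ b ≠ ⊤) :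
    a / b ≠ 0 ∧ a / b ≠ ⊤ :=
  ⟨ENNReal.div_ne_zero.2 ⟨ha.1, hb.2⟩, ENNReal.div_ne_top ha.2 hb.1⟩

/-- The entropy inequality behind the Ruzsa triangle inequality for Markov chains. -/
theorem IsMarkovChain.entropy_sub_pair_add_le [StandardBorelSpace G] [Nonempty G]
    [lam.IsNegInvariant] [IsProbabilityMeasure P] {X₁ Y X₂ : Ω → G}
    (hX₁ : Measurable X₁) (hY : Measurable Y) (hX₂ : Measurable X₂)
    (hM : IsMarkovChain P X₁ Y X₂)
    (h₁ : HasFiniteEntropy P lam X₁) (h : HasFiniteEntropy P lam Y)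
    (h₂ : HasFiniteEntropy P lam X₂) (h₁Y : HasFiniteEntropy P (lam.prod lam) (pair X₁ Y))
    (h₂Y : HasFiniteEntropy P (lam.prod lam) (pair X₂ Y))
    (hq : HasFiniteEntropy P (lam.prod lam) (pair (fun ω => X₁ ω - X₂ ω) Y))
    (hu : HasFiniteEntropy P lam (fun ω => X₁ ω - Y ω))
    (hv : HasFiniteEntropy P lam (fun ω => Y ω - X₂ ω)) :
    entropy P (lam.prod lam) (pair (fun ω => X₁ ω - X₂ ω) Y) +
        entropy P (lam.prod lam) (pair X₁ Y) + entropy P (lam.prod lam) (pair X₂ Y) ≤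
      entropy P lam X₁ + entropy P lam X₂ + entropy P lam (fun ω => X₁ ω - Y ω) +
        entropy P lam (fun ω => Y ω - X₂ ω) + 2 * entropy P lam Y := by
  have mX₁Y : Measurable (pair X₁ Y) := hX₁.prodMk hY
  have mX₂Y : Measurable (pair X₂ Y) := hX₂.prodMk hY
  have mU : Measurable fun ω => X₁ ω - Y ω := hX₁.sub hY
  have mV : Measurable fun ω => Y ω - X₂ ω := hY.sub hX₂
  have mQ : Measurable (pair (fun ω => X₁ ω - X₂ ω) Y) := (hX₁.sub hX₂).prodMk hY
  have d₁ := isDensity_rnDeriv hX₁ h₁.absolutelyContinuous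
  have d := isDensity_rnDeriv hY h.absolutelyContinuous
  have d₂ := isDensity_rnDeriv hX₂ h₂.absolutelyContinuous
  have d₁Y := isDensity_rnDeriv mX₁Y h₁Y.absolutelyContinuous
  have d₂Y := isDensity_rnDeriv mX₂Y h₂Y.absolutelyContinuous
  have dq := isDensity_rnDeriv mQ hq.absolutelyContinuous
  have du := isDensity_rnDeriv mU hu.absolutelyContinuous
  have dv := isDensity_rnDeriv mV hv.absolutelyContinuous
  have i₁ := h₁.integrable_log hX₁
  have i := h.integrable_log hY
  have i₂ := h₂.integrable_log hX₂
  have i₁Y := h₁Y.integrable_log mX₁Y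
  have i₂Y := h₂Y.integrable_log mX₂Y
  have iq := hq.integrable_log mQ
  have iu := hu.integrable_log mU
  have iv := hv.integrable_log mV
  have e₁ := h₁.integral_log hX₁
  have e := h.integral_log hY
  have e₂ := h₂.integral_log hX₂
  have e₁Y := h₁Y.integral_log mX₁Y
  have e₂Y := h₂Y.integral_log mX₂Y
  have eq := hq.integral_log mQ
  have eu := hu.integral_log mU
  have ev := hv.integral_log mV
  -- From here on the densities matter only through `IsDensity` and the integrals of their
  -- logarithms.
  generalize (P.map X₁).rnDeriv lam = f₁ at *
  generalize (P.map X₂).rnDeriv lam = f₂ at *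
  generalize (P.map Y).rnDeriv lam = f at *
  generalize (P.map (pair X₁ Y)).rnDeriv (lam.prod lam) = f₁Y at *
  generalize (P.map (pair X₂ Y)).rnDeriv (lam.prod lam) = f₂Y at *
  generalize (P.map (pair (fun ω => X₁ ω - X₂ ω) Y)).rnDeriv (lam.prod lam) = q at *
  generalize (P.map (fun ω => X₁ ω - Y ω)).rnDeriv lam = u at *
  generalize (P.map (fun ω => Y ω - X₂ ω)).rnDeriv lam = v at *
  have dT := hM.isDensity d₁Y d₂Y d
  -- The densities g of (X₁,X₂) and k of (U,V) are inherited from the triple; nothing is claimed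
  -- about their entropies.
  obtain ⟨g, dg⟩ : ∃ g, IsDensity P (lam.prod lam) (pair X₁ X₂) g :=
    ⟨_, isDensity_rnDeriv (hX₁.prodMk hX₂) (absolutelyContinuous_map_comp (φ := Prod.snd)
      Measure.quasiMeasurePreserving_snd dT.measurable_var dT.absolutelyContinuous)⟩
  obtain ⟨k, dk⟩ : ∃ k, IsDensity P (lam.prod lam)
      (pair (fun ω => X₁ ω - Y ω) (fun ω => Y ω - X₂ ω)) k :=
    ⟨_, isDensity_rnDeriv (mU.prodMk mV) (absolutelyContinuous_map_comp
      (φ := fun t : G × (G × G) => (t.2.1 - t.1, t.1 - t.2.2))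
      quasiMeasurePreserving_sub_sub dT.measurable_var dT.absolutelyContinuous)⟩
  have dm := dk.add
  simp only [sub_add_sub_cancel] at dm
  set m : G → ENNReal := fun d => ∫⁻ t, k (d - t, t) ∂lam with hm
  have mf₁ := d₁.measurable_density
  have mf := d.measurable_density
  have mf₂ := d₂.measurable_density
  have mf₁Y := d₁Y.measurable_density
  have mf₂Y := d₂Y.measurable_density
  have mq := dq.measurable_density
  have mu := du.measurable_density
  have mv := dv.measurable_density
  have mg := dg.measurable_density
  have mk := dk.measurable_density
  have mm := dm.measurable_density
  have prod_le {a b : G → ENNReal} {A B : Ω → G} (ha : IsDensity P lam A a)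
      (hb : IsDensity P lam B b) : ∫⁻ z, a z.1 * b z.2 ∂(lam.prod lam) ≤ 1 := by
    rw [lintegral_prod_mul ha.measurable_density.aemeasurable hb.measurable_density.aemeasurable,
      ha.lintegral_eq_one, hb.lintegral_eq_one, one_mul]
  -- Submodularity: the numerator g·k/m glues the laws of (X₁,X₂) and (U,V) along their common
  -- function X₁-X₂, and the denominator is the density of the triple.
  have r₁ : ∫⁻ ω, (g (X₁ ω, X₂ ω) * k (X₁ ω - Y ω, Y ω - X₂ ω) / m (X₁ ω - X₂ ω)) /
      (f₁Y (X₁ ω, Y ω) * (f₂Y (X₂ ω, Y ω) / f (Y ω))) ∂P ≤ 1 := by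
    have hG : Measurable fun t : G × (G × G) =>
        g t.2 * k (t.2.1 - t.1, t.1 - t.2.2) / m (t.2.1 - t.2.2) := by fun_prop
    refine (dT.lintegral_div_le hG).trans ?_
    rw [lintegral_prod_symm _ hG.aemeasurable]
    calc _ ≤ ∫⁻ x, g x ∂(lam.prod lam) := by
          refine lintegral_mono fun x => ?_
          simp only [mul_div_assoc]
          rw [lintegral_const_mul _ (by fun_prop)]
          simp only [div_eq_mul_inv]
          rw [lintegral_mul_const _ (by fun_prop), lintegral_sub_sub k x.1 x.2]
          -- The integral of k over y is m(x₁ - x₂), and m·m⁻¹ ≤ 1 holds even where m is 0 or ∞.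
          exact mul_le_of_le_one_right' (ENNReal.mul_inv_le_one _)
      _ = 1 := dg.lintegral_eq_one
      _ ≤ 1 := le_rfl
  -- The next three ratios encode subadditivity for (X₁,X₂), (U,V) and (X₁-X₂,Y).
  have r₂ : ∫⁻ ω, f₁ (X₁ ω) * f₂ (X₂ ω) / g (X₁ ω, X₂ ω) ∂P ≤ 1 :=
    (dg.lintegral_div_le (g := fun z => f₁ z.1 * f₂ z.2) (by fun_prop)).trans (prod_le d₁ d₂)
  have r₃ : ∫⁻ ω, u (X₁ ω - Y ω) * v (Y ω - X₂ ω) / k (X₁ ω - Y ω, Y ω - X₂ ω) ∂P ≤ 1 :=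
    (dk.lintegral_div_le (g := fun z => u z.1 * v z.2) (by fun_prop)).trans (prod_le du dv)
  have r₄ : ∫⁻ ω, m (X₁ ω - X₂ ω) * f (Y ω) / q (X₁ ω - X₂ ω, Y ω) ∂P ≤ 1 :=
    (dq.lintegral_div_le (g := fun z => m z.1 * f z.2) (by fun_prop)).trans (prod_le dm d)
  have hpos := d₁.ae_pos_finite.and <| d.ae_pos_finite.and <| d₂.ae_pos_finite.and <|
    d₁Y.ae_pos_finite.and <| d₂Y.ae_pos_finite.and <| dq.ae_pos_finite.and <|
    du.ae_pos_finite.and <| dv.ae_pos_finite.and <| dg.ae_pos_finite.and <|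
    dk.ae_pos_finite.and dm.ae_pos_finite
  simp only [pair] at hpos
  -- In the product of the four ratios g, k and m cancel, leaving f₁f₂uvf²/(f₁Y f₂Y q), whose
  -- factors all have integrable logarithms. One factor f comes from the Markov density, the other
  -- from the last ratio.
  have key := integral_nonpos_of_eq_sum_log (P := P) Finset.univ
    (R := ![fun ω => (g (X₁ ω, X₂ ω) * k (X₁ ω - Y ω, Y ω - X₂ ω) / m (X₁ ω - X₂ ω)) /
        (f₁Y (X₁ ω, Y ω) * (f₂Y (X₂ ω, Y ω) / f (Y ω))),
      fun ω => f₁ (X₁ ω) * f₂ (X₂ ω) / g (X₁ ω, X₂ ω),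
      fun ω => u (X₁ ω - Y ω) * v (Y ω - X₂ ω) / k (X₁ ω - Y ω, Y ω - X₂ ω),
      fun ω => m (X₁ ω - X₂ ω) * f (Y ω) / q (X₁ ω - X₂ ω, Y ω)])
    ?_ ?_ ?_
    (((((((i₁.add i₂).add iu).add iv).add (i.const_mul 2)).sub i₁Y).sub i₂Y).sub iq) ?_
  · rw [integral_sub' (by fun_prop) (by fun_prop), integral_sub' (by fun_prop) (by fun_prop),
      integral_sub' (by fun_prop) (by fun_prop), integral_add' (by fun_prop) (by fun_prop),
      integral_add' (by fun_prop) (by fun_prop), integral_add' (by fun_prop) (by fun_prop),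
      integral_add' (by fun_prop) (by fun_prop), integral_const_mul,
      e₁, e, e₂, e₁Y, e₂Y, eq, eu, ev] at key
    linarith
  · simp only [Finset.mem_univ, forall_const, Fin.forall_fin_succ]
    refine ⟨?_, ?_, ?_, ?_, fun i => i.elim0⟩ <;> simp <;> fun_prop
  · simp only [Finset.mem_univ, forall_const, Fin.forall_fin_succ]
    refine ⟨?_, ?_, ?_, ?_, fun i => i.elim0⟩ <;>
    · filter_upwards [hpos] with ω ⟨p₁, p, p₂, p₁Y, p₂Y, pq, pu, pv, pg, pk, pm⟩
      first
      | exact (div_ne_zero_ne_top (div_ne_zero_ne_top (mul_ne_zero_ne_top pg pk) pm)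
          (mul_ne_zero_ne_top p₁Y (div_ne_zero_ne_top p₂Y p))).1
      | exact (div_ne_zero_ne_top (mul_ne_zero_ne_top p₁ p₂) pg).1
      | exact (div_ne_zero_ne_top (mul_ne_zero_ne_top pu pv) pk).1
      | exact (div_ne_zero_ne_top (mul_ne_zero_ne_top pm p) pq).1
  · simp only [Finset.mem_univ, forall_const, Fin.forall_fin_succ]
    exact ⟨r₁, r₂, r₃, r₄, fun i => i.elim0⟩
  · filter_upwards [hpos] with ω ⟨p₁, p, p₂, p₁Y, p₂Y, pq, pu, pv, pg, pk, pm⟩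
    simp only [Fin.sum_univ_four, Matrix.cons_val, Pi.add_apply, Pi.sub_apply, pair]
    rw [log_toReal_div (div_ne_zero_ne_top (mul_ne_zero_ne_top pg pk) pm)
        (mul_ne_zero_ne_top p₁Y (div_ne_zero_ne_top p₂Y p)),
      log_toReal_div (mul_ne_zero_ne_top pg pk) pm,
      log_toReal_mul p₁Y (div_ne_zero_ne_top p₂Y p), log_toReal_mul pg pk,
      log_toReal_div p₂Y p, log_toReal_div (mul_ne_zero_ne_top p₁ p₂) pg, log_toReal_mul p₁ p₂,
      log_toReal_div (mul_ne_zero_ne_top pu pv) pk, log_toReal_mul pu pv,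
      log_toReal_div (mul_ne_zero_ne_top pm p) pq, log_toReal_mul pm p]
    ring

end Group

end RuzsaDiv

/-! ### The theorem, with the second bound from equality of joint laws. -/

theorem theorem3p8 {G : Type*} [AddCommGroup G] [TopologicalSpace G] [IsTopologicalAddGroup G]
    [PolishSpace G] [LocallyCompactSpace G] [MeasurableSpace G] [BorelSpace G]
    (lam : Measure G) [lam.IsAddHaarMeasure]
    {Ω : Type*} [MeasurableSpace Ω] (P : Measure Ω) [IsProbabilityMeasure P]
    (X₁ Y X₂ : Ω → G) (hX₁ : Measurable X₁) (hY : Measurable Y) (hX₂ : Measurable X₂)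
    (hMarkov : RuzsaDiv.IsMarkovChain P X₁ Y X₂)
    -- the entropies that occur in the claim are well defined and finite
    (h_X₁ : RuzsaDiv.HasFiniteEntropy P lam X₁)
    (h_Y : RuzsaDiv.HasFiniteEntropy P lam Y)
    (h_X₂ : RuzsaDiv.HasFiniteEntropy P lam X₂)
    (h_X₁Y : RuzsaDiv.HasFiniteEntropy P (lam.prod lam) (RuzsaDiv.pair X₁ Y))
    (h_X₂Y : RuzsaDiv.HasFiniteEntropy P (lam.prod lam) (RuzsaDiv.pair X₂ Y))
    (h_diffY : RuzsaDiv.HasFiniteEntropy P (lam.prod lam)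
      (RuzsaDiv.pair (fun ω => X₁ ω - X₂ ω) Y))
    (h_X₁subY : RuzsaDiv.HasFiniteEntropy P lam (fun ω => X₁ ω - Y ω))
    (h_YsubX₂ : RuzsaDiv.HasFiniteEntropy P lam (fun ω => Y ω - X₂ ω)) :
    RuzsaDiv.condRuzsaDivergence P lam X₁ X₂ Y ≤
        2 * RuzsaDiv.mutualInfo P lam X₁ Y + RuzsaDiv.mutualInfo P lam X₂ Y +
          RuzsaDiv.ruzsaDifference P lam X₁ Y + RuzsaDiv.ruzsaDifference P lam Y X₂ ∧
      ∀ X : Ω → G, Measurable X →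
        RuzsaDiv.SameCondDistrib P X₁ X Y → RuzsaDiv.SameCondDistrib P X₂ X Y →
        RuzsaDiv.condRuzsaDivergence P lam X₁ X₂ Y ≤
          3 * RuzsaDiv.mutualInfo P lam X Y +
            RuzsaDiv.ruzsaDifference P lam X Y + RuzsaDiv.ruzsaDifference P lam Y X := by
  have main := hMarkov.entropy_sub_pair_add_le hX₁ hY hX₂ h_X₁ h_Y h_X₂ h_X₁Y h_X₂Y h_diffY
    h_X₁subY h_YsubX₂
  unfold RuzsaDiv.condRuzsaDivergence RuzsaDiv.condEntropy RuzsaDiv.mutualInfo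
    RuzsaDiv.ruzsaDifference
  refine ⟨by linarith, fun X hX hs₁ hs₂ => ?_⟩
  have q₁ := hs₁.map_pair_eq hX₁ hX hY
  have q₂ := hs₂.map_pair_eq hX₂ hX hY
  -- Since (X₁,Y), (X₂,Y) and (X,Y) have the same law, every entropy of a function of such a pair
  -- may be rewritten in terms of X.
  have comp {W : Ω → G} (hW : Measurable W) (hq : P.map (RuzsaDiv.pair W Y) =
      P.map (RuzsaDiv.pair X Y)) {φ : G × G → G} (hφ : Measurable φ) :
      RuzsaDiv.entropy P lam (fun ω => φ (W ω, Y ω)) =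
        RuzsaDiv.entropy P lam (fun ω => φ (X ω, Y ω)) := by
    refine RuzsaDiv.entropy_congr_map ?_
    have := congrArg (Measure.map φ) hq
    exact (Measure.map_map hφ (hW.prodMk hY)).symm.trans
      (this.trans (Measure.map_map hφ (hX.prodMk hY)))
  have a₁ := RuzsaDiv.entropy_congr_map (μ := lam.prod lam) q₁
  have a₂ := RuzsaDiv.entropy_congr_map (μ := lam.prod lam) q₂
  have b₁ := comp hX₁ q₁ measurable_fst
  have b₂ := comp hX₂ q₂ measurable_fst
  have c₁ := comp hX₁ q₁ (φ := fun p => p.1 - p.2) (by fun_prop)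
  have c₂ := comp hX₂ q₂ (φ := fun p => p.2 - p.1) (by fun_prop)
  simp only [] at b₁ b₂ c₁ c₂
  linarith
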